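/- Let $r \ge 2$ be an integer. For $n \in \mathbb{N} = \{0,1,2,\dots\}$ let $b_n^{(r)} = 0$ if the binary expansion of $n$ contains a (maximal) block of consecutive $0$'s of length not divisible by $r$, and $b_n^{(r)} = 1$ otherwise, with $b_0^{(r)} = 1$. Let $B_r = \sum_{n\ge 0} b_n^{(r)} X^n \in \mathbb{F}_2[\![X]\!]$, let $Q_r = \sum_{n \ge 0} q_n^{(r)} X^n \in \mathbb{F}_2[\![X]\!]$ be the formal inverse of $D_r = X B_r$, i.e. the unique power series with zero constant term satisfying $D_r(Q_r(X)) = Q_r(D_r(X)) = X$, and let $(v_n^{(r)})_{n\in\mathbb{N}}$ be the characteristic sequence of $0$'s in $(q_n^{(r)})_{n \in \mathbb{N}}$, i.e. the strictly increasing sequence of natural numbers with $\{v_n^{(r)} : n \in \mathbb{N}\} = \{m \in \mathbb{N} : q_m^{(r)} = 0\}$. For an integer $k \ge 2$, a sequence $(u_n)_{n\in\mathbb{N}}$ of integers is called $k$-regular if there are finitely many integer sequences $(s_n^{(1)})_{n\in\mathbb{N}}, \dots, (s_n^{(m)})_{n\in\mathbb{N}}$ such that for all $i \ge 0$ and $0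 \le j < k^i$ there are integers $a_1,\dots,a_m$ with $u_{k^i n + j} = \sum_{t=1}^m a_t s_n^{(t)}$ for all $n \in \mathbb{N}$. **Theorem.** For every $r \ge 2$, the sequence $(v_n^{(r)})_{n\in\mathbb{N}}$ is not $k$-regular for any $k \ge 2$. -/

import Mathlib

noncomputable section

namespace BaumSweet

/-- The `k`-kernel of a sequence `u`: the set of all subsequences `n ↦ u (k ^ i * n + j)`
with `i ≥ 0` and `0 ≤ j < k ^ i`. -/
def kKernel {M : Type*} (k : ℕ) (u : ℕ → M) : Set (ℕ → M) :=
  {t | ∃ i j : ℕ, j < k ^ i ∧ t = fun n => u (k ^ i * n + j)}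

/-- A sequence `u` with values in a `ℤ`-module `M` is `k`-regular if there are finitely many
sequences `s 0, …, s (m - 1)` in `M` such that every sequence in the `k`-kernel of `u` is a
linear combination of them with (constant) integer coefficients. -/
def IsRegularSeq {M : Type*} [AddCommGroup M] (k : ℕ) (u : ℕ → M) : Prop :=
  ∃ (m : ℕ) (s : Fin m → ℕ → M), ∀ t ∈ kKernel k u,
    ∃ a : Fin m → ℤ, ∀ n : ℕ, t n = ∑ i, a i • s i n

/-- The binary expansion of `n` contains a (maximal) block of exactly `L` consecutive `0`s.
The list `Nat.digits 2 n` is the binary expansion, least significant digit first; it has no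
leading zeros, and it is empty for `n = 0`. -/
def HasZeroBlock (n L : ℕ) : Prop :=
  0 < L ∧ ∃ l₁ l₂ : List ℕ,
    Nat.digits 2 n = l₁ ++ List.replicate L 0 ++ l₂ ∧
      l₁.getLast? ≠ some 0 ∧ l₂.head? ≠ some 0

open Classical in
/-- The generalized Baum--Sweet sequence `b⁽ʳ⁾` with values in `𝔽₂`: the term is `0` if the
binary expansion of `n` contains a block of `0`s of length not divisible by `r`, and `1`
otherwise (in particular `b⁽ʳ⁾₀ = 1`). -/
def bs (r n : ℕ) : ZMod 2 :=
  if ∃ L : ℕ, HasZeroBlock n L ∧ ¬ r ∣ L then 0 else 1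

/-- The power series `B_r = ∑ b⁽ʳ⁾ₙ Xⁿ` over `𝔽₂`. -/
def bsSeries (r : ℕ) : PowerSeries (ZMod 2) :=
  PowerSeries.mk (bs r)

/-- The power series `D_r = X · B_r` over `𝔽₂`. -/
def shiftedSeries (r : ℕ) : PowerSeries (ZMod 2) :=
  PowerSeries.X * bsSeries r

theorem bs_zero (r : ℕ) : bs r 0 = 1 := by
  unfold bs
  rw [if_neg]
  rintro ⟨L, ⟨hL, l₁, l₂, h, -, -⟩, -⟩
  have := congrArg List.length h
  simp at this
  omega

theorem constantCoeff_shiftedSeries (r : ℕ) :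
    PowerSeries.constantCoeff (shiftedSeries r) = 0 := by
  simp [shiftedSeries]

theorem isUnit_coeff_one_shiftedSeries (r : ℕ) :
    IsUnit (PowerSeries.coeff 1 (shiftedSeries r)) := by
  have h : PowerSeries.coeff 1 (shiftedSeries r) = 1 := by
    simp [shiftedSeries, bsSeries, bs_zero]
  rw [h]
  exact isUnit_one

/-- The formal inverse `Q_r` of `D_r = X · B_r`, i.e. its inverse under composition. -/
def inverseSeries (r : ℕ) : PowerSeries (ZMod 2) :=
  (shiftedSeries r).substInvOfIsUnit (isUnit_coeff_one_shiftedSeries r)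

/-- `D_r (Q_r (X)) = X` and `Q_r (D_r (X)) = X`. -/
theorem inverseSeries_spec (r : ℕ) :
    (shiftedSeries r).subst (inverseSeries r) = PowerSeries.X ∧
      (inverseSeries r).subst (shiftedSeries r) = PowerSeries.X :=
  ⟨PowerSeries.subst_substInvOfIsUnit_right _ (constantCoeff_shiftedSeries r) _,
    PowerSeries.subst_substInvOfIsUnit_left _ (constantCoeff_shiftedSeries r) _⟩

/-- The coefficient sequence `q⁽ʳ⁾` of the formal inverse `Q_r`. -/
def q (r n : ℕ) : ZMod 2 :=
  PowerSeries.coeff n (inverseSeries r)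

/-- The characteristic sequence `v⁽ʳ⁾` of `0`s in `q⁽ʳ⁾`: the indices `m` with `q⁽ʳ⁾ₘ = 0`,
enumerated in increasing order, starting with the index `n = 0`. -/
def v (r n : ℕ) : ℕ :=
  Nat.nth (fun m => q r m = 0) n

end BaumSweet

end

namespace BaumSweet

open PowerSeries

/-! Splitting off trailing binary digits gives B = X B² + B^(2^r). Substituting Q = X P turns this
into P = (1 + X) P^(2^r), so q_{m+1} ≠ 0 exactly when all base-2^r digits of m are 0 or 1. Such m
below 2^(ru) number 2^u and lie in the lower half. Hence v n = n + 2^u on a long run of indices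
ending at t_u = 2^(ru) - 2^u, where v jumps by 3 (`v_eq_add`, `v_succ_of_jump`).

If v is k-regular, the increments mod 4 along a block of length k^i depend only on one of finitely
many colours of the block. For given i, pigeonhole among boundedly many u with 2^(ru) comparable to
k^i yields u < u' with equally coloured blocks around the jumps, so k^i divides t_{u'} - t_u = 2^u ·
odd, with bounded quotient (`pow_bounds`). Up to constants, the 2-part of k^i is thus 2^u while k^i
is 2^(ru). Writing k = 2^s g with g odd and letting i grow forces k = 2^(rs), so g = 2^((r-1)s) is
even, a contradiction. -/

/-! ### Digit recursions for the Baum–Sweet sequence -/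

theorem hasZeroBlock_two_pow_mul_odd (a m L : ℕ) :
    HasZeroBlock (2 ^ a * (2 * m + 1)) L ↔ (0 < L ∧ L = a) ∨ HasZeroBlock m L := by
  have hd : Nat.digits 2 (2 ^ a * (2 * m + 1)) = List.replicate a 0 ++ 1 :: Nat.digits 2 m := by
    rw [Nat.digits_base_pow_mul (by norm_num) (by omega), add_comm,
      Nat.digits_add 2 (by norm_num) 1 m (by norm_num) (by norm_num)]
  unfold HasZeroBlock
  rw [hd]
  constructor
  · rintro ⟨hL, l₁, l₂, h, h₁, h₂⟩
    rw [List.append_assoc] at h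
    -- Either the block starts after the trailing zeros, hence lies in the digits of `m`, or `l₁`
    -- consists of trailing zeros only and maximality makes it empty.
    rcases List.append_eq_append_iff.1 h with ⟨c, hc, hc'⟩ | ⟨c, hc, hc'⟩
    · cases c with
      | nil =>
        obtain ⟨L, rfl⟩ := Nat.exists_eq_succ_of_ne_zero hL.ne'
        simp [List.replicate_succ] at hc'
      | cons x c =>
        rw [List.cons_append, List.cons.injEq] at hc'
        obtain ⟨rfl, hc'⟩ := hc'
        refine Or.inr ⟨hL, c, l₂, by rw [hc', List.append_assoc], ?_, h₂⟩
        rw [hc, List.getLast?_append, List.getLast?_cons] at h₁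
        cases hcl : c.getLast? with
        | none => simp
        | some y => simpa [hcl] using h₁
    · have h0 : l₁ = [] := by
        by_contra hne
        apply h₁
        rw [List.getLast?_eq_some_getLast hne]
        congr 1
        have : l₁.getLast hne ∈ List.replicate a 0 := by
          rw [hc]; exact List.mem_append_left _ (List.getLast_mem hne)
        exact List.eq_of_mem_replicate this
      subst h0
      refine Or.inl ⟨hL, ?_⟩
      rw [List.nil_append] at hc
      subst hc
      rcases List.append_eq_append_iff.1 hc' with ⟨e, he, he'⟩ | ⟨e, he, he'⟩
      · cases e with
        | nil => simpa using (congrArg List.length he).symm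
        | cons x e =>
          exfalso
          have hx : x = 0 := List.eq_of_mem_replicate (n := a) (by rw [he]; simp)
          simp [he', hx] at h₂
      · cases e with
        | nil => simpa using congrArg List.length he
        | cons x e =>
          exfalso
          have hx : x = 0 := List.eq_of_mem_replicate (n := L) (by rw [he]; simp)
          simp [hx] at he'
  · rintro (⟨hL, rfl⟩ | ⟨hL, l₁, l₂, h, h₁, h₂⟩)
    · exact ⟨hL, [], 1 :: Nat.digits 2 m, by simp, by simp, by simp⟩
    · refine ⟨hL, List.replicate a 0 ++ 1 :: l₁, l₂, by simp [h], ?_, h₂⟩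
      rw [List.getLast?_append, List.getLast?_cons]
      cases hcl : l₁.getLast? with
      | none => simp
      | some y => simpa [hcl] using h₁

theorem bs_two_pow_mul_odd (r a m : ℕ) :
    bs r (2 ^ a * (2 * m + 1)) = if r ∣ a then bs r m else 0 := by
  unfold bs
  by_cases h : r ∣ a
  · have e : (∃ L, HasZeroBlock (2 ^ a * (2 * m + 1)) L ∧ ¬ r ∣ L) ↔
        ∃ L, HasZeroBlock m L ∧ ¬ r ∣ L := by
      refine exists_congr fun L => ?_
      rw [hasZeroBlock_two_pow_mul_odd]
      constructor
      · rintro ⟨⟨-, rfl⟩ | hL, hr⟩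
        · exact absurd h hr
        · exact ⟨hL, hr⟩
      · exact fun ⟨hL, hr⟩ => ⟨Or.inr hL, hr⟩
    rw [if_pos h]
    by_cases hm : ∃ L, HasZeroBlock m L ∧ ¬ r ∣ L
    · rw [if_pos hm, if_pos (e.2 hm)]
    · rw [if_neg hm, if_neg (mt e.1 hm)]
  · rw [if_neg h, if_pos]
    refine ⟨a, (hasZeroBlock_two_pow_mul_odd a m a).2
      (Or.inl ⟨Nat.pos_of_ne_zero ?_, rfl⟩), h⟩
    rintro rfl
    exact h (dvd_zero r)

theorem bs_odd (r m : ℕ) : bs r (2 * m + 1) = bs r m := by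
  simpa using bs_two_pow_mul_odd r 0 m

theorem bs_two_pow_mul (r m : ℕ) : bs r (2 ^ r * m) = bs r m := by
  rcases eq_or_ne m 0 with rfl | hm
  · simp
  obtain ⟨a, n, ⟨n, rfl⟩, rfl⟩ := Nat.exists_eq_two_pow_mul_odd hm
  rw [← mul_assoc, ← pow_add, bs_two_pow_mul_odd, bs_two_pow_mul_odd]
  simp

theorem bs_even_of_not_dvd {r n : ℕ} (h2 : 2 ∣ n) (hr : ¬ 2 ^ r ∣ n) : bs r n = 0 := by
  have hn : n ≠ 0 := by rintro rfl; exact hr (dvd_zero _)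
  obtain ⟨a, n, ⟨n, rfl⟩, rfl⟩ := Nat.exists_eq_two_pow_mul_odd hn
  rw [bs_two_pow_mul_odd, if_neg]
  intro hra
  rcases Nat.eq_zero_or_pos a with rfl | ha
  · omega
  · exact hr (Dvd.dvd.mul_right (pow_dvd_pow 2 (Nat.le_of_dvd ha hra)) _)

/-! ### Functional equations of B_r and Q_r -/

theorem expand_two_pow_eq_pow (r : ℕ) (f : PowerSeries (ZMod 2)) :
    expand (2 ^ r) (by positivity) f = f ^ 2 ^ r := by
  have h := MvPowerSeries.map_iterateFrobenius_expand (R := ZMod 2) (p := 2) (by norm_num) (f := f) r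
  rw [← h, Subsingleton.elim (iterateFrobenius (ZMod 2) 2 r) (RingHom.id _)]
  simp [expand]

theorem bsSeries_eq (r : ℕ) (hr : 1 ≤ r) :
    bsSeries r = X * bsSeries r ^ 2 + bsSeries r ^ 2 ^ r := by
  have h2 : expand 2 two_ne_zero (bsSeries r) = bsSeries r ^ 2 :=
    expand_two_pow_eq_pow 1 (bsSeries r)
  rw [← h2, ← expand_two_pow_eq_pow]
  ext n
  rw [map_add]
  rcases Nat.even_or_odd' n with ⟨m, rfl | rfl⟩
  · have h0 : coeff (2 * m) (X * expand 2 two_ne_zero (bsSeries r)) = 0 := by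
      cases m with
      | zero => simp
      | succ m =>
        rw [show 2 * (m + 1) = (2 * m + 1) + 1 by ring, coeff_succ_X_mul,
          coeff_expand_of_not_dvd]
        omega
    rw [h0, zero_add, coeff_expand]
    split_ifs with h
    · obtain ⟨j, hj⟩ := h
      simp [hj, bsSeries, bs_two_pow_mul]
    · simp [bsSeries, bs_even_of_not_dvd (Dvd.intro m rfl) h]
  · rw [coeff_succ_X_mul, coeff_expand_mul, coeff_expand_of_not_dvd]
    · simp [bsSeries, bs_odd]
    · intro h
      have := (dvd_pow_self 2 (by omega : r ≠ 0)).trans h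
      omega

/-- The functional equation of `P = Q_r / X`. -/
theorem inverseSeries_eq (r : ℕ) (hr : 1 ≤ r) :
    ∃ P : PowerSeries (ZMod 2), inverseSeries r = X * P ∧ constantCoeff P = 1 ∧
      P = (1 + X) * P ^ 2 ^ r := by
  have hcc : constantCoeff (inverseSeries r) = 0 := by simp [inverseSeries]
  obtain ⟨P, hP⟩ := X_dvd_iff.2 hcc
  have hP1 : constantCoeff P = 1 := by
    have h1 : coeff 1 (inverseSeries r) ≠ 0 := by
      simpa [inverseSeries] using (isUnit_coeff_one_shiftedSeries r).ne_zero
    rw [hP, show (1 : ℕ) = 0 + 1 from rfl, coeff_succ_X_mul] at h1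
    rw [coeff_zero_eq_constantCoeff_apply] at h1
    generalize constantCoeff P = x at h1 ⊢
    revert x; decide
  refine ⟨P, hP, hP1, ?_⟩
  have hs : HasSubst (inverseSeries r) := HasSubst.of_constantCoeff_zero' hcc
  obtain ⟨N, hN⟩ : ∃ N, 2 ^ r = N + 1 := Nat.exists_eq_succ_of_ne_zero (by positivity)
  -- Multiplying the equation of B by X^(2^r) makes it polynomial in X and D, so that substituting Q
  -- merely exchanges X with Q and D with X.
  have hD : X ^ N * shiftedSeries r = X ^ N * shiftedSeries r ^ 2 + shiftedSeries r ^ (N + 1) := by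
    have h := congrArg (X ^ (N + 1) * ·) (bsSeries_eq r hr)
    rw [hN] at h
    simp only [shiftedSeries]
    linear_combination h
  have hQ := congrArg (substAlgHom (R := ZMod 2) hs) hD
  simp only [map_mul, map_add, map_pow] at hQ
  rw [coe_substAlgHom, (inverseSeries_spec r).1, subst_X hs, hP] at hQ
  have hX : (X : PowerSeries (ZMod 2)) ^ (N + 1) ≠ 0 := pow_ne_zero _ X_ne_zero
  have h1 : P ^ N = X * P ^ N + 1 := by
    apply mul_left_cancel₀ hX
    linear_combination hQ
  have h2 : (X : PowerSeries (ZMod 2)) * P ^ (N + 1) = - (X * P ^ (N + 1)) := by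
    ext n
    simp only [map_neg]
    exact (ZMod.neg_eq_self_mod_two _).symm
  rw [hN]
  linear_combination (-P) * h1 - h2

/-! ### Support of q in base 2^r -/

theorem q_zero (r : ℕ) : q r 0 = 0 := by
  simp [q, inverseSeries]

theorem q_one (r : ℕ) (hr : 1 ≤ r) : q r 1 = 1 := by
  obtain ⟨P, hP, hP1, -⟩ := inverseSeries_eq r hr
  rw [q, hP, show (1 : ℕ) = 0 + 1 from rfl, coeff_succ_X_mul,
    coeff_zero_eq_constantCoeff_apply, hP1]

/-- P^(2^r) is supported on multiples of 2^r, so the factor 1 + X fills only the residues 0 and 1.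
-/
theorem q_two_pow_mul_add (r : ℕ) (hr : 2 ≤ r) (n e : ℕ) (he : e < 2 ^ r) :
    q r (2 ^ r * n + e + 1) = if e ≤ 1 then q r (n + 1) else 0 := by
  obtain ⟨P, hP, -, hP2⟩ := inverseSeries_eq r (by omega)
  have h4 : 2 ^ 2 ≤ 2 ^ r := Nat.pow_le_pow_right (by norm_num) hr
  have hnd : ∀ e, 0 < e → e < 2 ^ r → coeff (2 ^ r * n + e) (P ^ 2 ^ r) = 0 := by
    intro e h0 he
    rw [← expand_two_pow_eq_pow, coeff_expand_of_not_dvd]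
    rw [Nat.dvd_add_right (Dvd.intro _ rfl)]
    exact Nat.not_dvd_of_pos_of_lt h0 he
  have hd : coeff (2 ^ r * n) (P ^ 2 ^ r) = coeff n P := by
    rw [← expand_two_pow_eq_pow, coeff_expand_mul]
  simp only [q, hP, coeff_succ_X_mul]
  have hsplit : coeff (2 ^ r * n + e) P =
      coeff (2 ^ r * n + e) (P ^ 2 ^ r) + coeff (2 ^ r * n + e) (X * P ^ 2 ^ r) := by
    rw [← map_add, ← one_add_mul, ← hP2]
  rw [hsplit]
  match e with
  | 0 =>
    rw [add_zero, hd, if_pos (by norm_num)]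
    cases n with
    | zero => simp
    | succ n =>
      have h : 2 ^ r * (n + 1) = 2 ^ r * n + (2 ^ r - 1) + 1 := by
        rw [mul_add]; omega
      have hnd' : coeff (2 ^ r * n + (2 ^ r - 1)) (P ^ 2 ^ r) = 0 := by
        rw [← expand_two_pow_eq_pow, coeff_expand_of_not_dvd]
        rw [Nat.dvd_add_right (Dvd.intro _ rfl)]
        exact Nat.not_dvd_of_pos_of_lt (by omega) (by omega)
      rw [h, coeff_succ_X_mul, hnd', add_zero]
  | 1 =>
    rw [hnd 1 (by norm_num) he, coeff_succ_X_mul, hd]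
    simp
  | e + 2 =>
    rw [hnd (e + 2) (by omega) he, if_neg (by omega), ← add_assoc (2 ^ r * n) (e + 1) 1,
      coeff_succ_X_mul, hnd (e + 1) (by omega) (by omega), add_zero]

theorem count_two_pow_mul (r : ℕ) (hr : 2 ≤ r) (n : ℕ) :
    Nat.count (fun m => q r (m + 1) ≠ 0) (2 ^ r * n) =
      2 * Nat.count (fun m => q r (m + 1) ≠ 0) n := by
  have h4 : 2 ^ 2 ≤ 2 ^ r := Nat.pow_le_pow_right (by norm_num) hr
  induction n with
  | zero => simp
  | succ n ih =>
    rw [mul_add, mul_one, Nat.count_add, ih, Nat.count_succ, mul_add]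
    congr 1
    obtain ⟨N, hN⟩ := Nat.exists_eq_add_of_le (show 2 ≤ 2 ^ r by omega)
    have key : ∀ e < 2 ^ r, q r (2 ^ r * n + e + 1) = if e ≤ 1 then q r (n + 1) else 0 :=
      q_two_pow_mul_add r hr n
    have hz : Nat.count (fun e => q r (2 ^ r * n + (2 + e) + 1) ≠ 0) N = 0 := by
      rw [Nat.count_iff_forall_not]
      intro e he
      rw [key (2 + e) (by omega), if_neg (by omega)]
      simp
    have h0 := key 0 (by omega)
    have h1 := key 1 (by omega)
    simp only [zero_le, le_refl, if_true] at h0 h1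
    have e1 : Nat.count (fun e => q r (2 ^ r * n + e + 1) ≠ 0) (2 ^ r) =
        Nat.count (fun e => q r (2 ^ r * n + e + 1) ≠ 0) (2 + N) := by rw [← hN]
    rw [e1, Nat.count_add, hz, Nat.count_succ, Nat.count_succ, Nat.count_zero, h0, h1]
    split_ifs <;> rfl

theorem count_two_pow (r : ℕ) (hr : 2 ≤ r) (u : ℕ) :
    Nat.count (fun m => q r (m + 1) ≠ 0) (2 ^ (r * u)) = 2 ^ u := by
  induction u with
  | zero =>
    rw [mul_zero, pow_zero, Nat.count_one, if_pos]
    simp [q_one r (by omega)]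
  | succ u ih => rw [mul_add, mul_one, add_comm, pow_add, count_two_pow_mul r hr, ih, pow_succ']

/-- Digits at most 1 in a base at least 4 keep m in the lower half; this produces the long zero run
of q before 2^(ru). -/
theorem two_mul_lt_of_q_ne_zero (r : ℕ) (hr : 2 ≤ r) (u : ℕ) :
    ∀ m < 2 ^ (r * u), q r (m + 1) ≠ 0 → 2 * m < 2 ^ (r * u) := by
  have h4 : 2 ^ 2 ≤ 2 ^ r := Nat.pow_le_pow_right (by norm_num) hr
  induction u with
  | zero => intro m hm _; simp at hm ⊢; omega
  | succ u ih =>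
    intro m hm hq
    have hpow : 2 ^ (r * (u + 1)) = 2 ^ r * 2 ^ (r * u) := by
      rw [mul_add, mul_one, add_comm, pow_add]
    have he := Nat.mod_lt m (show 2 ^ r > 0 by omega)
    have hdm := Nat.div_add_mod m (2 ^ r)
    have hk := q_two_pow_mul_add r hr (m / 2 ^ r) (m % 2 ^ r) he
    rw [hdm] at hk
    rw [hk] at hq
    rw [hpow] at hm ⊢
    split_ifs at hq with h1
    · have hn := ih _ (Nat.div_lt_of_lt_mul hm) hq
      have : 2 ^ r * (2 * (m / 2 ^ r) + 1) ≤ 2 ^ r * 2 ^ (r * u) := Nat.mul_le_mul_left _ hn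
      have e : 2 ^ r * (2 * (m / 2 ^ r) + 1) = 2 * (2 ^ r * (m / 2 ^ r)) + 2 ^ r := by ring
      omega
    · exact absurd rfl hq

theorem q_two_pow_add_one (r : ℕ) (hr : 2 ≤ r) (u : ℕ) : q r (2 ^ (r * u) + 1) = 1 := by
  have h4 : 2 ^ 2 ≤ 2 ^ r := Nat.pow_le_pow_right (by norm_num) hr
  induction u with
  | zero =>
    have := q_two_pow_mul_add r hr 0 1 (by omega)
    simpa [q_one r (by omega)] using this
  | succ u ih =>
    have := q_two_pow_mul_add r hr (2 ^ (r * u)) 0 (by omega)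
    rw [mul_add, mul_one, add_comm, add_comm (r * u), pow_add, add_comm]
    simpa [ih] using this

theorem q_two_pow_add (r : ℕ) (hr : 2 ≤ r) (u : ℕ) (hu : 1 ≤ u) (e : ℕ) (he : e < 2 ^ r) :
    q r (2 ^ (r * u) + e + 1) = if e ≤ 1 then 1 else 0 := by
  obtain ⟨u, rfl⟩ := Nat.exists_eq_add_of_le' hu
  rw [mul_add, mul_one, add_comm (r * u), pow_add, q_two_pow_mul_add r hr _ e he,
    q_two_pow_add_one r hr]

/-! ### Runs and jumps of v -/

theorem q_eq_zero_of_le (r : ℕ) (hr : 2 ≤ r) (u m : ℕ) (h₁ : m ≤ 2 ^ (r * u))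
    (h₂ : 2 ^ (r * u) + 2 ≤ 2 * m) : q r m = 0 := by
  by_contra h
  obtain ⟨m, rfl⟩ : ∃ m', m = m' + 1 := ⟨m - 1, by omega⟩
  have := two_mul_lt_of_q_ne_zero r hr u m (by omega) h
  omega

theorem count_q_eq_zero (r : ℕ) (hr : 2 ≤ r) (u : ℕ) :
    Nat.count (fun m => q r m = 0) (2 ^ (r * u) + 1) + 2 ^ u = 2 ^ (r * u) + 1 := by
  have hcompl : ∀ n, Nat.count (fun m => q r (m + 1) = 0) n +
      Nat.count (fun m => q r (m + 1) ≠ 0) n = n := by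
    intro n
    induction n with
    | zero => simp
    | succ n ih =>
      rw [Nat.count_succ, Nat.count_succ]
      by_cases h : q r (n + 1) = 0
      · rw [if_pos h, if_neg (not_not.2 h)]
        omega
      · rw [if_neg h, if_pos h]
        omega
  have h := hcompl (2 ^ (r * u))
  rw [count_two_pow r hr] at h
  rw [Nat.count_succ', if_pos (q_zero r)]
  omega

theorem count_q_eq_zero_sub (r : ℕ) (hr : 2 ≤ r) (u : ℕ) (h m : ℕ) (hm : m + h = 2 ^ (r * u))
    (hle : 2 * h + 2 ≤ 2 ^ (r * u)) :
    Nat.count (fun m => q r m = 0) m + 2 ^ u = m := by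
  induction h generalizing m with
  | zero =>
    have hc := count_q_eq_zero r hr u
    rw [Nat.count_succ, if_pos (q_eq_zero_of_le r hr u _ le_rfl (by omega))] at hc
    rw [add_zero] at hm
    rw [hm]
    omega
  | succ h ih =>
    have hc := ih (m + 1) (by omega) (by omega)
    rw [Nat.count_succ, if_pos (q_eq_zero_of_le r hr u _ (by omega) (by omega))] at hc
    omega

/-- Here `h` is the distance from the zero n + 2^u of q to the end 2^(ru) of its run; exactly 2^u
indices below that zero are nonzeros. -/
theorem v_eq_add (r : ℕ) (hr : 2 ≤ r) (u n h : ℕ) (hn : n + 2 ^ u + h = 2 ^ (r * u))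
    (hle : 2 * h + 2 ≤ 2 ^ (r * u)) : v r n = n + 2 ^ u := by
  have hc := count_q_eq_zero_sub r hr u h (n + 2 ^ u) hn hle
  have := Nat.nth_count (p := fun m => q r m = 0)
    (q_eq_zero_of_le r hr u (n + 2 ^ u) (by omega) (by omega))
  rwa [Nat.add_right_cancel hc] at this

theorem v_succ_of_gap (r : ℕ) (hr : 2 ≤ r) (u n h : ℕ) (hn : n + 2 ^ u + h = 2 ^ (r * u))
    (h1 : 1 ≤ h) (hle : 2 * h + 2 ≤ 2 ^ (r * u)) : v r (n + 1) = v r n + 1 := by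
  rw [v_eq_add r hr u n h hn hle, v_eq_add r hr u (n + 1) (h - 1) (by omega) (by omega)]
  omega

/-- After the zero at 2^(ru), q is nonzero at the next two indices and vanishes at the third. -/
theorem v_succ_of_jump (r : ℕ) (hr : 2 ≤ r) (u n : ℕ) (hu : 1 ≤ u) (hn : n + 2 ^ u = 2 ^ (r * u)) :
    v r (n + 1) = v r n + 3 := by
  have h4 : 2 ^ 2 ≤ 2 ^ r := Nat.pow_le_pow_right (by norm_num) hr
  have hle : 2 ^ r ≤ 2 ^ (r * u) := Nat.pow_le_pow_right (by norm_num) (Nat.le_mul_of_pos_right r hu)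
  rw [v_eq_add r hr u n 0 hn (by omega), hn]
  have hc := count_q_eq_zero r hr u
  have h1 := q_two_pow_add r hr u hu 0 (by omega)
  have h2 := q_two_pow_add r hr u hu 1 (by omega)
  have h3 := q_two_pow_add r hr u hu 2 (by omega)
  simp only [zero_le, le_refl, if_true, add_zero, show ¬ (2 ≤ 1) by norm_num, if_false] at h1 h2 h3
  have hc3 : Nat.count (fun m => q r m = 0) (2 ^ (r * u) + 1 + 1 + 1) = n + 1 := by
    rw [Nat.count_succ, Nat.count_succ, h1, h2, if_neg one_ne_zero]
    omega
  have := Nat.nth_count (p := fun m => q r m = 0) h3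
  rw [show 2 ^ (r * u) + 2 + 1 = 2 ^ (r * u) + 1 + 1 + 1 from rfl, hc3] at this
  exact this

/-! ### Regularity and the positions of jumps -/

/-- A regular sequence admits a finite colouring of its indices such that the blocks of any
level over two indices of the same colour have the same increments modulo `4`. -/
theorem IsRegularSeq.exists_coloring {k : ℕ} {u : ℕ → ℕ} (h : IsRegularSeq k fun n => (u n : ℤ)) :
    ∃ (m : ℕ) (c : ℕ → (Fin m → ZMod 4) × (Fin m → ZMod 4)), ∀ n n', c n = c n' →
      ∀ i j, j < k ^ i →
        (u (k ^ i * n + j + 1) : ZMod 4) - u (k ^ i * n + j) =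
          (u (k ^ i * n' + j + 1) : ZMod 4) - u (k ^ i * n' + j) := by
  obtain ⟨m, s, hs⟩ := h
  -- The values at n + 1 are needed for the last increment, which crosses into the next block.
  refine ⟨m, fun n => (fun l => (s l n : ZMod 4), fun l => (s l (n + 1) : ZMod 4)), ?_⟩
  intro n n' hc i j hj
  rw [Prod.mk.injEq] at hc
  have key : ∀ j < k ^ i, ∃ a : Fin m → ℤ, ∀ n,
      (u (k ^ i * n + j) : ZMod 4) = ∑ l, (a l : ZMod 4) * (s l n : ZMod 4) := by
    intro j hj
    obtain ⟨a, ha⟩ := hs _ ⟨i, j, hj, rfl⟩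
    refine ⟨a, fun n => ?_⟩
    have := congrArg (Int.cast : ℤ → ZMod 4) (ha n)
    simpa using this
  have h0 : ∀ j < k ^ i, (u (k ^ i * n + j) : ZMod 4) = u (k ^ i * n' + j) := by
    intro j hj
    obtain ⟨a, ha⟩ := key j hj
    rw [ha, ha]
    exact Finset.sum_congr rfl fun l _ => by rw [congrFun hc.1 l]
  have h1 : (u (k ^ i * n + j + 1) : ZMod 4) = u (k ^ i * n' + j + 1) := by
    rcases Nat.lt_or_ge (j + 1) (k ^ i) with hlt | hge
    · exact h0 (j + 1) hlt
    · obtain ⟨a, ha⟩ := key 0 (by omega)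
      have e : ∀ n, k ^ i * n + j + 1 = k ^ i * (n + 1) + 0 := by
        intro n; rw [mul_add]; omega
      rw [e, e, ha, ha]
      exact Finset.sum_congr rfl fun l _ => by rw [congrFun hc.2 l]
  rw [h0 j hj, h1]

theorem le_of_forall_pow_le {a b M : ℕ} (h : ∀ i, a ^ i ≤ M * b ^ i) : a ≤ b := by
  by_contra! hab
  rcases Nat.eq_zero_or_pos b with rfl | hb
  · have := h 1
    simp at this
    omega
  have hb' : (0 : ℝ) < b := by exact_mod_cast hb
  obtain ⟨i, hi⟩ := pow_unbounded_of_one_lt (M : ℝ)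
    (show (1 : ℝ) < a / b by rw [one_lt_div hb']; exact_mod_cast hab)
  rw [div_pow, lt_div_iff₀ (by positivity)] at hi
  exact absurd (h i) (not_le.2 (by exact_mod_cast hi))

/-- If two blocks of level `i` have the same increments modulo `4`, then the jumps at
`2 ^ (r * u) - 2 ^ u` and `2 ^ (r * u') - 2 ^ u'` have the same position in their blocks. -/
theorem jump_position_le {r : ℕ} (hr : 2 ≤ r) {ℓ u u' t t' : ℕ} (hu : 1 ≤ u)
    (ht : t + 2 ^ u = 2 ^ (r * u)) (ht' : t' + 2 ^ u' = 2 ^ (r * u'))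
    (hℓ : 0 < ℓ) (hℓ' : 2 * ℓ + 2 ≤ 2 ^ (r * u'))
    (h : ∀ j < ℓ, (v r (ℓ * (t / ℓ) + j + 1) : ZMod 4) - v r (ℓ * (t / ℓ) + j) =
      (v r (ℓ * (t' / ℓ) + j + 1) : ZMod 4) - v r (ℓ * (t' / ℓ) + j)) :
    t' % ℓ ≤ t % ℓ := by
  by_contra! hlt
  have hj := h (t % ℓ) (Nat.mod_lt _ hℓ)
  have hd := Nat.div_add_mod t' ℓ
  have hm := Nat.mod_lt t' hℓ
  -- At offset `t % ℓ` the first block has increment 3, while the second, still before its own jump,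
  -- has increment 1; these differ modulo 4.
  rw [Nat.div_add_mod, v_succ_of_jump r hr u t hu ht,
    v_succ_of_gap r hr u' _ (t' % ℓ - t % ℓ) (by omega) (by omega) (by omega)] at hj
  push_cast at hj
  rw [add_sub_cancel_left, add_sub_cancel_left] at hj
  revert hj
  decide

theorem jump_modEq {r : ℕ} (hr : 2 ≤ r) {ℓ u u' t t' : ℕ} (hu : 1 ≤ u) (hu' : 1 ≤ u')
    (ht : t + 2 ^ u = 2 ^ (r * u)) (ht' : t' + 2 ^ u' = 2 ^ (r * u'))
    (hℓ : 0 < ℓ) (hℓ₁ : 2 * ℓ + 2 ≤ 2 ^ (r * u)) (hℓ₂ : 2 * ℓ + 2 ≤ 2 ^ (r * u'))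
    (h : ∀ j < ℓ, (v r (ℓ * (t / ℓ) + j + 1) : ZMod 4) - v r (ℓ * (t / ℓ) + j) =
      (v r (ℓ * (t' / ℓ) + j + 1) : ZMod 4) - v r (ℓ * (t' / ℓ) + j)) :
    t ≡ t' [MOD ℓ] :=
  le_antisymm (jump_position_le hr hu' ht' ht hℓ hℓ₁ fun j hj => (h j hj).symm)
    (jump_position_le hr hu ht ht' hℓ hℓ₂ h)

/-! ### 2-adic valuations and the growth of k^i -/

/-- The difference of the jumps at `2 ^ (r * u) - 2 ^ u` and `2 ^ (r * u') - 2 ^ u'` has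
`2`-adic valuation `u` when `u < u'`. -/
theorem exists_odd_jump_sub {r : ℕ} (hr : 2 ≤ r) {u h t t' : ℕ} (hu : 1 ≤ u) (hh : 1 ≤ h)
    (ht : t + 2 ^ u = 2 ^ (r * u)) (ht' : t' + 2 ^ (u + h) = 2 ^ (r * (u + h))) :
    ∃ o, Odd o ∧ t' = t + 2 ^ u * o := by
  obtain ⟨r, rfl⟩ := Nat.exists_eq_add_of_le' (show 1 ≤ r by omega)
  have e1 : 2 ^ ((r + 1) * u) = 2 ^ u * 2 ^ (r * u) := by rw [← pow_add]; ring_nf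
  have e2 : 2 ^ ((r + 1) * (u + h)) = 2 ^ u * (2 ^ (r * u) * 2 ^ ((r + 1) * h)) := by
    rw [← pow_add, ← pow_add]; ring_nf
  obtain ⟨x, hx⟩ : 2 ∣ 2 ^ (r * u) := dvd_pow_self 2 (Nat.mul_ne_zero (by omega) (by omega))
  obtain ⟨y, hy⟩ : 2 ∣ 2 ^ h := dvd_pow_self 2 (by omega)
  have hle : 2 ^ h ≤ 2 ^ ((r + 1) * h) :=
    Nat.pow_le_pow_right (by norm_num) (Nat.le_mul_of_pos_left h (by omega))
  have hx1 : 1 ≤ x := by have := Nat.pow_pos (n := r * u) (show 0 < 2 by norm_num); omega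
  have hy1 : 1 ≤ y := by have := Nat.pow_pos (n := h) (show 0 < 2 by norm_num); omega
  obtain ⟨z, hz⟩ := Nat.exists_eq_add_of_le hle
  -- This is (t' - t) / 2^u, where the shifted r gives 2^(ru) = 2x, 2^h = 2y and 2^((r+1)h) = 2y +
  -- z.
  refine ⟨2 * x * (2 * y + z - 1) + 1 - 2 * y, ?_, ?_⟩
  · have : 2 * y ≤ 2 * x * (2 * y + z - 1) := by
      nlinarith [Nat.sub_add_cancel (show 1 ≤ 2 * y + z by omega)]
    rw [← Nat.not_even_iff_odd, Nat.even_iff]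
    rw [mul_assoc] at this ⊢
    omega
  · have h3 : 2 * y ≤ 2 * x * (2 * y + z - 1) + 1 := by
      nlinarith [Nat.sub_add_cancel (show 1 ≤ 2 * y + z by omega)]
    rw [e1, hx] at ht
    rw [e2, hx, hz, hy, pow_add, hy] at ht'
    zify [h3, show 1 ≤ 2 * y + z by omega] at *
    linear_combination ht' - ht

/-- The bound `M` must not depend on `i`: it says that k^i agrees up to bounded factors with 2^(ru)
in size and with 2^u in its 2-part. -/
theorem pow_bounds {r : ℕ} (hr : 2 ≤ r) {k : ℕ} (hk : 2 ≤ k)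
    (hreg : IsRegularSeq k fun n => (v r n : ℤ)) :
    ∃ M, ∀ i, ∃ u o e, Odd o ∧ 0 < e ∧ e ≤ M ∧ 2 ^ u * o = k ^ i * e ∧
      k ^ i ≤ 2 ^ (r * u) ∧ 2 ^ (r * u) ≤ M * k ^ i := by
  obtain ⟨m, c, hc⟩ := hreg.exists_coloring
  let C := Fintype.card ((Fin m → ZMod 4) × (Fin m → ZMod 4))
  refine ⟨2 ^ (r * C) * (2 ^ r * 4), fun i => ?_⟩
  have hki : 0 < k ^ i := by positivity
  -- The least w with 4k^i ≤ 2^(rw); the factor 4 leaves room for a whole block in the run before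
  -- each jump, and minimality gives the upper bound.
  obtain ⟨w, hw, hw1, hw2⟩ : ∃ w, 1 ≤ w ∧ 4 * k ^ i ≤ 2 ^ (r * w) ∧
      2 ^ (r * w) ≤ 2 ^ r * (4 * k ^ i) := by
    have hex : ∃ w, 4 * k ^ i ≤ 2 ^ (r * w) := by
      refine ⟨4 * k ^ i, Nat.lt_two_pow_self.le.trans (Nat.pow_le_pow_right (by norm_num) ?_)⟩
      exact Nat.le_mul_of_pos_left _ (by omega)
    have h1 : 1 ≤ Nat.find hex := by
      rw [Nat.one_le_iff_ne_zero]
      intro h0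
      have := Nat.find_spec hex
      rw [h0, mul_zero, pow_zero] at this
      omega
    refine ⟨Nat.find hex, h1, Nat.find_spec hex, ?_⟩
    have h2 := Nat.find_min hex (m := Nat.find hex - 1) (by omega)
    have h3 : r * Nat.find hex = r + r * (Nat.find hex - 1) := by
      obtain ⟨n, hn⟩ := Nat.exists_eq_add_of_le' h1
      rw [hn, Nat.add_sub_cancel, mul_add, mul_one, add_comm]
    rw [h3, pow_add]
    exact Nat.mul_le_mul_left _ (by omega)
  have hjump : ∀ u, ∃ t, t + 2 ^ u = 2 ^ (r * u) := fun u =>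
    ⟨2 ^ (r * u) - 2 ^ u, Nat.sub_add_cancel
      (Nat.pow_le_pow_right (by norm_num) (Nat.le_mul_of_pos_left u (by omega)))⟩
  choose t ht using hjump
  obtain ⟨x, y, hxy, hcxy⟩ : ∃ x y : Fin (C + 1), x < y ∧
      c (t (w + x) / k ^ i) = c (t (w + y) / k ^ i) := by
    obtain ⟨x, y, hne, he⟩ := Fintype.exists_ne_map_eq_of_card_lt
      (fun x : Fin (C + 1) => c (t (w + x) / k ^ i)) (by rw [Fintype.card_fin]; exact Nat.lt_succ_self C)
    rcases lt_or_gt_of_ne hne with h | h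
    · exact ⟨x, y, h, he⟩
    · exact ⟨y, x, h, he.symm⟩
  have hlow : ∀ z, 4 * k ^ i ≤ 2 ^ (r * (w + z)) := fun z =>
    hw1.trans (Nat.pow_le_pow_right (by norm_num) (Nat.mul_le_mul_left _ (by omega)))
  have hhigh : ∀ z : Fin (C + 1), 2 ^ (r * (w + z)) ≤ 2 ^ (r * C) * (2 ^ r * 4) * k ^ i := by
    intro z
    calc 2 ^ (r * (w + z)) = 2 ^ (r * z) * 2 ^ (r * w) := by rw [← pow_add]; ring_nf
      _ ≤ 2 ^ (r * C) * (2 ^ r * (4 * k ^ i)) :=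
        Nat.mul_le_mul (Nat.pow_le_pow_right (by norm_num)
          (Nat.mul_le_mul_left _ (Nat.lt_succ_iff.1 z.2))) hw2
      _ = _ := by ring
  have hmod := jump_modEq hr (by omega) (by omega) (ht (w + x)) (ht (w + y)) hki
    (by have := hlow x; omega) (by have := hlow y; omega) (hc _ _ hcxy i)
  obtain ⟨h, hh⟩ := Nat.exists_eq_add_of_lt (show (x : ℕ) < y from hxy)
  have hwy : w + y = w + x + (h + 1) := by omega
  have hty := ht (w + y)
  rw [hwy] at hty
  obtain ⟨o, ho, hto⟩ := exists_odd_jump_sub hr (by omega) (by omega) (ht (w + x)) hty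
  rw [hwy, hto] at hmod
  obtain ⟨e, he⟩ : k ^ i ∣ 2 ^ (w + (x : ℕ)) * o := by
    have := (Nat.modEq_iff_dvd' (Nat.le_add_right _ _)).1 hmod
    rwa [Nat.add_sub_cancel_left] at this
  refine ⟨w + x, o, e, ho, ?_, ?_, he, ?_, hhigh x⟩
  · rw [Nat.pos_iff_ne_zero]
    rintro rfl
    have := Nat.pow_pos (n := w + (x : ℕ)) (show 0 < 2 by norm_num)
    have := Nat.mul_pos this ho.pos
    omega
  · refine Nat.le_of_mul_le_mul_left ?_ hki
    rw [← he]
    have := hhigh y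
    have := Nat.pow_pos (n := w + (y : ℕ)) (show 0 < 2 by norm_num)
    have := ht (w + y)
    rw [hwy, hto, ← hwy] at this
    rw [mul_comm (k ^ i)]
    omega
  · have := hlow x
    omega

end BaumSweet

theorem mainTheorem10 (r : ℕ) (hr : 2 ≤ r) (k : ℕ) (hk : 2 ≤ k) :
    ¬ BaumSweet.IsRegularSeq k (fun n => (BaumSweet.v r n : ℤ)) := by
  intro hreg
  obtain ⟨M, hM⟩ := BaumSweet.pow_bounds hr hk hreg
  obtain ⟨s, g, hg, hkg⟩ := Nat.exists_eq_two_pow_mul_odd (show k ≠ 0 by omega)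
  have hle : ∀ i, (2 ^ (r * s)) ^ i ≤ M * k ^ i ∧ k ^ i ≤ M ^ r * (2 ^ (r * s)) ^ i := by
    intro i
    obtain ⟨u, o, e, ho, he, heM, hoe, h₁, h₂⟩ := hM i
    have hpow : k ^ i = 2 ^ (s * i) * g ^ i := by rw [hkg, mul_pow, pow_mul]
    -- Comparing powers of 2 in 2^u o = 2^(si) g^i e with o and g odd gives 2^(si) ≤ 2^u ≤ M 2^(si).
    have hsu : 2 ^ (s * i) ≤ 2 ^ u := by
      refine Nat.le_of_dvd (by positivity) ?_
      refine Nat.Coprime.dvd_of_dvd_mul_right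
        (Nat.Coprime.pow_left _ (Nat.coprime_two_left.2 ho)) ?_
      rw [hoe, hpow, mul_assoc]
      exact Dvd.intro _ rfl
    have hus : 2 ^ u ≤ 2 ^ (s * i) * M := by
      refine le_trans (Nat.le_of_dvd (by positivity) ?_) (Nat.mul_le_mul_left _ heM)
      refine Nat.Coprime.dvd_of_dvd_mul_right (Nat.Coprime.pow_left _
        (Nat.coprime_two_left.2 hg.pow)) (m := 2 ^ (s * i) * e) (n := g ^ i) ⟨o, ?_⟩
      rw [hoe, hpow]
      ring
    have e1 : (2 ^ (r * s)) ^ i = (2 ^ (s * i)) ^ r := by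
      rw [← pow_mul, ← pow_mul]; ring_nf
    have e2 : 2 ^ (r * u) = (2 ^ u) ^ r := by rw [← pow_mul]; ring_nf
    rw [e2] at h₁ h₂
    rw [e1]
    refine ⟨(Nat.pow_le_pow_left hsu r).trans h₂, h₁.trans ?_⟩
    rw [← mul_pow, mul_comm M]
    exact Nat.pow_le_pow_left hus r
  have hk' : k = 2 ^ (r * s) :=
    le_antisymm (BaumSweet.le_of_forall_pow_le fun i => (hle i).2)
      (BaumSweet.le_of_forall_pow_le fun i => (hle i).1)
  have hs : s ≠ 0 := by
    rintro rfl
    simp at hk'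
    omega
  have hg2 : g = 2 ^ ((r - 1) * s) := by
    obtain ⟨n, rfl⟩ := Nat.exists_eq_add_of_le' (show 1 ≤ r by omega)
    refine Nat.eq_of_mul_eq_mul_left (show 0 < 2 ^ s by positivity) ?_
    rw [← hkg, hk', ← pow_add, Nat.add_sub_cancel, add_mul, one_mul, add_comm]
  have : 2 ∣ g := hg2 ▸ dvd_pow_self 2 (Nat.mul_ne_zero (by omega) hs)
  exact Nat.not_even_iff_odd.2 hg (even_iff_two_dvd.2 this)
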